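/- Let $N\ge 1$ and consider a two-hop relay link with a single-antenna source and destination and an $N$-antenna relay. The channel vectors $h_1,h_I,h_2\in\mathbb C^N$ (source–relay, interferer–relay, relay–destination) are mutually independent and have i.i.d. entries distributed as circularly symmetric complex Gaussians $\mathcal{CN}(0,\sigma_1^2)$, $\mathcal{CN}(0,\sigma_I^2)$, $\mathcal{CN}(0,\sigma_2^2)$, respectively. The source, relay and interferer have powers $P,P_r,P_I>0$, and the noise power at the relay (per antenna) and at the destination is $N_0>0$. Put $$\rho_1=\frac{P\sigma_1^2}{N_0},\qquad \rho_2=\frac{P_r\sigma_2^2}{N_0},\qquad \rho_I=\frac{P_I\sigma_I^2}{N_0}.$$ For a relay matrix $W$ the end-to-end signal-to-interference-and-noise ratio is $$\gamma=\frac{|h_2^\dagger W h_1|^2P}{|h_2^\dagger W h_I|^2P_I+|h_2^\dagger W|^2N_0+N_0}.$$ In the variable-gain scheme without interference-channel information the relay uses $$W=w\,\frac{h_2h_1^\dagger}{|h_2||h_1|},\qquad w^2=\frac{P_r}{\mathbb E\left\{|h_1|^2P+|h_1^\dagger h_I|^2P_I/|h_1|^2+N_0\right\}}.$$ Let $P_{\rm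 out}(\gamma_{\rm th})=\Pr(\gamma\le\gamma_{\rm th})$ be the outage probability at a threshold $\gamma_{\rm th}>0$. Fix $N$, $\gamma_{\rm th}$, $\rho_I$ and $\mu>0$, and let the system parameters vary with $\rho_2=\mu\rho_1$ and $\rho_1\to\infty$. Then $$P_{\rm out}(\gamma_{\rm th})\sim\sum_{i=0}^{N-1}\frac{(-1)^{N-i}\left(\ln\frac{N\gamma_{\rm th}}{\mu\rho_1}-\psi(1)-\psi(N-i+1)\right)}{\Gamma(N)\Gamma(i+1)\Gamma(N-i+1)}\left(\frac{N\gamma_{\rm th}}{\mu\rho_1}\right)^N,$$ where $\psi$ is the digamma function and $\sim$ means that the ratio of the two sides tends to $1$. Moreover, $P_{\rm out}(\gamma_{\rm th})$ is of exact order $\rho_1^{-N}\ln\rho_1$, and the diversity order is $N$: $$\lim_{\rho_1\to\infty}\frac{-\ln P_{\rm out}(\gamma_{\rm th})}{\ln\rho_1}=N.$$ -/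

import Mathlib

open MeasureTheory ProbabilityTheory Filter Topology Asymptotics
open scoped Matrix

noncomputable section

/-- The circularly symmetric complex Gaussian law `CN(0, σ²)` on `ℂ`: real and imaginary parts are
independent real Gaussians of mean `0` and variance `σ² / 2`. -/
def complexGaussian (σ : ℝ) : Measure ℂ :=
  ((gaussianReal 0 (σ ^ 2 / 2).toNNReal).prod (gaussianReal 0 (σ ^ 2 / 2).toNNReal)).map
    Complex.measurableEquivRealProd.symm

/-- The squared Euclidean (Frobenius) norm `|v|² = ∑ᵢ |vᵢ|²` of a complex vector. -/
def sqNorm {N : ℕ} (v : Fin N → ℂ) : ℝ := ∑ i, ‖v i‖ ^ 2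

/-- The physical parameters of a dual-hop relay link with one interferer at the relay. -/
structure RelayParams where
  /-- source transmit power -/
  P : ℝ
  /-- relay transmit power -/
  Pr : ℝ
  /-- interferer transmit power -/
  PI : ℝ
  /-- noise power -/
  N₀ : ℝ
  /-- standard deviation of the source-relay channel entries -/
  σ₁ : ℝ
  /-- standard deviation of the relay-destination channel entries -/
  σ₂ : ℝ
  /-- standard deviation of the interferer-relay channel entries -/
  σI : ℝ
  P_pos : 0 < P
  Pr_pos : 0 < Pr
  PI_pos : 0 < PI
  N₀_pos : 0 < N₀
  σ₁_pos : 0 < σ₁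
  σ₂_pos : 0 < σ₂
  σI_pos : 0 < σI

namespace RelayParams

/-- Average SNR `ρ₁ = P σ₁² / N₀` of the source-relay link. -/
def ρ₁ (p : RelayParams) : ℝ := p.P * p.σ₁ ^ 2 / p.N₀

/-- Average SNR `ρ₂ = P_r σ₂² / N₀` of the relay-destination link. -/
def ρ₂ (p : RelayParams) : ℝ := p.Pr * p.σ₂ ^ 2 / p.N₀

/-- Average interference-to-noise ratio `ρ_I = P_I σ_I² / N₀` at the relay. -/
def ρI (p : RelayParams) : ℝ := p.PI * p.σI ^ 2 / p.N₀

/-- A realization `(h₁, h_I, h₂)` of the source-relay, interferer-relay and relay-destination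
channel vectors when the relay has `N` antennas. -/
abbrev Channels (N : ℕ) : Type := (Fin N → ℂ) × (Fin N → ℂ) × (Fin N → ℂ)

/-- The joint law of `(h₁, h_I, h₂)`: the three vectors are independent, with i.i.d. entries
`CN(0, σ₁²)`, `CN(0, σ_I²)` and `CN(0, σ₂²)` respectively. -/
def channelLaw (p : RelayParams) (N : ℕ) : Measure (Channels N) :=
  (Measure.pi fun _ => complexGaussian p.σ₁).prod
    ((Measure.pi fun _ => complexGaussian p.σI).prod (Measure.pi fun _ => complexGaussian p.σ₂))

/-- End-to-end SINR of the 1-N-1 system for a relay matrix `W`; the received signal is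
`h₂† W (h₁ s + h_I s_I + n₁) + n₂`. -/
def sinr (p : RelayParams) {N : ℕ} (W : Matrix (Fin N) (Fin N) ℂ) (h : Channels N) : ℝ :=
  ‖star h.2.2 ⬝ᵥ (W *ᵥ h.1)‖ ^ 2 * p.P /
    (‖star h.2.2 ⬝ᵥ (W *ᵥ h.2.1)‖ ^ 2 * p.PI + sqNorm (star h.2.2 ᵥ* W) * p.N₀ + p.N₀)

/-- `E{ h₁†h₁ P + |h₁†h_I|² P_I / |h₁|² + N₀ }`: the mean power after maximal ratio combining at
the relay, before amplification. -/
def meanCombinedPower (p : RelayParams) (N : ℕ) : ℝ :=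
  ∫ h, (sqNorm h.1 * p.P + ‖star h.1 ⬝ᵥ h.2.1‖ ^ 2 * p.PI / sqNorm h.1 + p.N₀) ∂(p.channelLaw N)

/-- The relay gain `w` without interference channel information: `w² = P_r / E{ ⋯ }`, so that the
mean power transmitted by the relay is `P_r`. -/
def gainNoICI (p : RelayParams) (N : ℕ) : ℝ := √(p.Pr / p.meanCombinedPower N)

/-- The maximal ratio combining / transmission matrix `W = w h₂ h₁† / (|h₂| |h₁|)`. -/
def relayMatrixNoICI (p : RelayParams) {N : ℕ} (h : Channels N) : Matrix (Fin N) (Fin N) ℂ :=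
  ((p.gainNoICI N / (√(sqNorm h.2.2) * √(sqNorm h.1)) : ℝ) : ℂ) •
    Matrix.vecMulVec h.2.2 (star h.1)

/-- Outage probability `Pr(γ ≤ γ_th)` of the 1-N-1 variable-gain system without interference
channel information. -/
def outageNoICI (p : RelayParams) (N : ℕ) (γth : ℝ) : ℝ :=
  (p.channelLaw N).real {h | p.sinr (p.relayMatrixNoICI h) h ≤ γth}

end RelayParams

/-- The high-SNR expression
`∑_{i<N} (-1)^{N-i} (ln z - ψ(1) - ψ(N-i+1)) / (Γ(N) Γ(i+1) Γ(N-i+1)) · z^N`, `z = N γ_th / (μ ρ₁)`.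
Here `ψ` is the digamma function, and `i < N`, so `N - i` is an honest difference. -/
def highSNROutage (N : ℕ) (μ γth ρ : ℝ) : ℝ :=
  ∑ i ∈ Finset.range N,
    (-1 : ℝ) ^ (N - i) *
        (Real.log (N * γth / (μ * ρ)) - (Complex.digamma 1).re - (Complex.digamma ((N : ℂ) - i + 1)).re) /
      (Real.Gamma N * Real.Gamma ((i : ℝ) + 1) * Real.Gamma ((N : ℝ) - i + 1)) *
    (N * γth / (μ * ρ)) ^ N

end

/-!
With `X = |h₁|² / σ₁²`, `Z = |h_I|² / σ_I²`, `Y = |h₂|² / σ₂²`, three independent `Gamma(N, 1)`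
variables, and `δ = γ_th E{⋯} / (N₀ ρ₁ ρ₂)`, the outage event contains `{XY ≤ δ}` and, because
`|h₁†h_I|² / |h₁|² ≤ |h_I|²` by Cauchy-Schwarz, is contained in
`{X ≤ (γ_th / ρ₁) (ρ_I Z + 1) + δ / Y}`. The exact law of the interference is therefore not needed.

The Gamma law of a squared norm comes from the volume of the complex Euclidean ball
(`map_pi_complexGaussian_sqNorm_div`). As `Pr(X ≤ x)` is between `e^{-x} xᴺ / N!` and `xᴺ / N!`,
both probabilities are governed by the truncated moment `E[Y⁻ᴺ; Y > δ]`. The density of `Y` is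
`yᴺ⁻¹ e^{-y} / (N-1)!`, so the integrand is essentially `1 / y`, and the moment grows like
`-ln δ / (N-1)!`; the term with the interference has no such logarithm. With `L = -ln δ`,
`le_prod_gammaMeasure_mul_le` and `prod_gammaMeasure_le` then squeeze the outage probability between
multiples of `δᴺ L / (N! (N-1)!)` whose factors tend to `1` (`RelayParams.tendsto_outageNoICI_div`).

The same Cauchy-Schwarz bound gives `E{⋯} / N₀ = N ρ₁ + O(1)`, hence `δ ρ₁ → κ = N γ_th / μ`, and
`P_out ρ₁ᴺ / ln ρ₁ → κᴺ / (N! (N-1)!)`. In the closed-form expression the digamma values are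
constants next to the logarithm, and the alternating sum of the coefficients of the logarithm is
`-1 / (N! (N-1)!)` by the binomial theorem applied to `(1 - 1)ᴺ`, so it has the same leading term.
The order of decay and the diversity order follow from this limit.
-/

noncomputable section

/-! ### The law of the squared norm of a complex Gaussian vector -/

lemma withDensity_comp_map {α β : Type*} [MeasurableSpace α] [MeasurableSpace β] (μ : Measure α)
    {f : α → β} {g : β → ENNReal} (hf : Measurable f) (hg : Measurable g) :
    (μ.withDensity (fun x => g (f x))).map f = (μ.map f).withDensity g := by
  ext s hs
  rw [Measure.map_apply hf hs, withDensity_apply _ (hf hs), withDensity_apply _ hs,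
    setLIntegral_map hs hg hf]

lemma lintegral_pi_fin_prod {α : Type*} [MeasurableSpace α] (μ : Measure α) [SigmaFinite μ]
    {n : ℕ} (f : Fin n → α → ENNReal) (hf : ∀ i, Measurable (f i)) :
    ∫⁻ x : Fin n → α, ∏ i, f i (x i) ∂(Measure.pi fun _ => μ) = ∏ i, ∫⁻ x, f i x ∂μ := by
  induction n with
  | zero => simp
  | succ n ih =>
    rw [← ((measurePreserving_piFinSuccAbove (fun _ : Fin (n + 1) => μ) 0).symm).lintegral_comp_emb
      (MeasurableEquiv.measurableEmbedding _)]
    simp_rw [MeasurableEquiv.piFinSuccAbove_symm_apply, Fin.insertNthEquiv,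
      Fin.prod_univ_succ, Fin.insertNth_zero, Equiv.coe_fn_mk, Fin.cons_succ, Fin.cons_zero]
    rw [← ih _ fun i => hf i.succ]
    exact lintegral_prod_mul (hf 0).aemeasurable
      (Finset.univ.measurable_prod fun (i : Fin n) _ =>
        (hf i.succ).comp (measurable_pi_apply i)).aemeasurable

lemma pi_withDensity_fin {α : Type*} [MeasurableSpace α] (μ : Measure α) [SigmaFinite μ]
    {n : ℕ} {g : α → ENNReal} (hg : Measurable g) [SigmaFinite (μ.withDensity g)] :
    (Measure.pi fun _ : Fin n => μ.withDensity g) =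
      (Measure.pi fun _ => μ).withDensity fun x => ∏ i, g (x i) := by
  refine Measure.pi_eq fun s hs => ?_
  rw [withDensity_apply _ (MeasurableSet.univ_pi hs),
    ← lintegral_indicator (MeasurableSet.univ_pi hs)]
  simp_rw [withDensity_apply _ (hs _), ← lintegral_indicator (hs _)]
  rw [← lintegral_pi_fin_prod μ (fun i => (s i).indicator g) fun i => hg.indicator (hs i)]
  congr 1 with x
  by_cases hx : x ∈ Set.univ.pi s
  · rw [Set.indicator_of_mem hx]
    exact Finset.prod_congr rfl fun i _ => (Set.indicator_of_mem (hx i trivial) _).symm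
  · rw [Set.indicator_of_notMem hx]
    simp only [Set.mem_pi, Set.mem_univ, true_imp_iff, not_forall] at hx
    obtain ⟨i, hi⟩ := hx
    exact (Finset.prod_eq_zero (Finset.mem_univ i) (Set.indicator_of_notMem hi _)).symm

lemma complexGaussian_eq_withDensity {σ : ℝ} (hσ : 0 < σ) :
    complexGaussian σ = volume.withDensity fun z : ℂ =>
      ENNReal.ofReal (Real.exp (-(‖z‖ ^ 2 / σ ^ 2)) / (Real.pi * σ ^ 2)) := by
  have hv : (σ ^ 2 / 2).toNNReal ≠ 0 := by
    rw [ne_eq, Real.toNNReal_eq_zero, not_le]; positivity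
  have hv' : (((σ ^ 2 / 2).toNNReal : NNReal) : ℝ) = σ ^ 2 / 2 :=
    Real.coe_toNNReal _ (by positivity)
  rw [complexGaussian, gaussianReal_of_var_ne_zero _ hv,
    prod_withDensity (measurable_gaussianPDF _ _) (measurable_gaussianPDF _ _),
    ← Measure.volume_eq_prod, ← Complex.volume_preserving_equiv_real_prod.map_eq,
    ← withDensity_comp_map _ Complex.measurableEquivRealProd.measurable (by fun_prop),
    Measure.map_map Complex.measurableEquivRealProd.symm.measurable
      Complex.measurableEquivRealProd.measurable,
    MeasurableEquiv.symm_comp_self, Measure.map_id]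
  congr 1 with z
  rw [Complex.measurableEquivRealProd_apply, gaussianPDF, gaussianPDF, gaussianPDFReal,
    gaussianPDFReal, ← ENNReal.ofReal_mul (by positivity), hv']
  congr 1
  rw [mul_mul_mul_comm, ← Real.exp_add, ← mul_inv, Real.mul_self_sqrt (by positivity),
    Complex.sq_norm, Complex.normSq_apply, mul_comm, ← div_eq_mul_inv]
  congr 1
  · congr 1
    field_simp
    ring
  · ring

lemma isProbabilityMeasure_complexGaussian (σ : ℝ) : IsProbabilityMeasure (complexGaussian σ) :=
  Measure.isProbabilityMeasure_map (by fun_prop)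

lemma sqNorm_nonneg {N : ℕ} (v : Fin N → ℂ) : 0 ≤ sqNorm v := by
  unfold sqNorm; positivity

@[fun_prop]
lemma measurable_sqNorm {N : ℕ} : Measurable (sqNorm : (Fin N → ℂ) → ℝ) := by
  unfold sqNorm; fun_prop

lemma volume_sqNorm_le {N : ℕ} (hN : 1 ≤ N) {r : ℝ} (hr : 0 ≤ r) :
    volume {v : Fin N → ℂ | sqNorm v ≤ r} =
      ENNReal.ofReal (Real.pi ^ N * r ^ N / N.factorial) := by
  have : Nonempty (Fin N) := ⟨⟨0, hN⟩⟩
  have h := Complex.volume_sum_rpow_le (Fin N) one_le_two √r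
  have hset : {v : Fin N → ℂ | (∑ i, ‖v i‖ ^ (2 : ℝ)) ^ (1 / 2 : ℝ) ≤ √r} =
      {v | sqNorm v ≤ r} := by
    ext v
    simp only [Set.mem_ofPred_eq, ← Real.sqrt_eq_rpow, Real.rpow_two]
    rw [Real.sqrt_le_sqrt_iff hr]; rfl
  rw [← hset, h, Fintype.card_fin, ← ENNReal.ofReal_pow (Real.sqrt_nonneg _),
    ← ENNReal.ofReal_mul (by positivity), pow_mul, Real.sq_sqrt hr,
    mul_div_cancel_left₀ _ (two_ne_zero' ℝ), Real.Gamma_nat_eq_factorial,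
    div_self (two_ne_zero' ℝ), one_add_one_eq_two, Real.Gamma_two, mul_one]
  congr 1; ring

lemma ext_of_measure_Iic (μ ν : Measure ℝ) (hμ : ∀ a, μ (Set.Iic a) ≠ ⊤)
    (h : ∀ a, μ (Set.Iic a) = ν (Set.Iic a)) : μ = ν := by
  refine Measure.ext_of_Ioc' μ ν (fun a b _ => ?_) fun a b hab => ?_
  · exact ne_top_of_le_ne_top (hμ b) (measure_mono Set.Ioc_subset_Iic_self)
  · have hd : Set.Ioc a b = Set.Iic b \ Set.Iic a := by
      ext x; simp [and_comm]
    rw [hd, measure_sdiff (Set.Iic_subset_Iic.2 hab.le)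
      measurableSet_Iic.nullMeasurableSet (hμ a), measure_sdiff (Set.Iic_subset_Iic.2 hab.le)
      measurableSet_Iic.nullMeasurableSet (h a ▸ hμ a), h a, h b]

lemma setLIntegral_Icc_const_mul_pow {N : ℕ} (hN : 1 ≤ N) {c b : ℝ} (hc : 0 ≤ c) (hb : 0 ≤ b) :
    ∫⁻ r in Set.Icc 0 b, ENNReal.ofReal (c * r ^ (N - 1)) = ENNReal.ofReal (c * b ^ N / N) := by
  rw [setLIntegral_congr Ioc_ae_eq_Icc.symm, ← ofReal_integral_eq_lintegral_ofReal,
    ← intervalIntegral.integral_of_le hb, intervalIntegral.integral_const_mul, integral_pow]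
  · have hN' : (((N - 1 : ℕ) : ℝ) + 1) = N := by
      exact_mod_cast Nat.sub_add_cancel hN
    rw [hN', Nat.sub_add_cancel hN, zero_pow (by omega), sub_zero, mul_div_assoc]
  · exact (Continuous.integrableOn_Icc (by fun_prop)).mono_set Set.Ioc_subset_Icc_self
  · refine (ae_restrict_iff' measurableSet_Ioc).2 (ae_of_all _ fun x hx => ?_)
    have := hx.1
    simp only [Pi.zero_apply]
    positivity

lemma gammaPDF_natCast_one {N : ℕ} (hN : 1 ≤ N) {x : ℝ} (hx : 0 ≤ x) :
    gammaPDF N 1 x = ENNReal.ofReal (x ^ (N - 1) * Real.exp (-x) / (N - 1).factorial) := by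
  rw [gammaPDF_of_nonneg hx]
  have h1 : Real.Gamma N = (N - 1).factorial := by
    rw [← Real.Gamma_nat_eq_factorial, Nat.cast_sub hN, Nat.cast_one, sub_add_cancel]
  have h2 : x ^ ((N : ℝ) - 1) = x ^ (N - 1) := by
    rw [← Real.rpow_natCast, Nat.cast_sub hN, Nat.cast_one]
  rw [h1, h2, Real.one_rpow, one_mul]
  congr 1
  ring

/-- Polar coordinates: the image of Lebesgue measure on `ℂᴺ` under `v ↦ |v|² / σ²`. -/
lemma map_volume_sqNorm_div {N : ℕ} (hN : 1 ≤ N) {σ : ℝ} (hσ : 0 < σ) :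
    (volume : Measure (Fin N → ℂ)).map (fun v => sqNorm v / σ ^ 2) =
      volume.withDensity ((Set.Ici 0).indicator fun r =>
        ENNReal.ofReal ((Real.pi * σ ^ 2) ^ N / (N - 1).factorial * r ^ (N - 1))) := by
  have hm : Measurable fun v : Fin N → ℂ => sqNorm v / σ ^ 2 := by fun_prop
  have hpre (a : ℝ) : (fun v : Fin N → ℂ => sqNorm v / σ ^ 2) ⁻¹' Set.Iic a =
      {v | sqNorm v ≤ a * σ ^ 2} := by
    ext v; simp [div_le_iff₀ (pow_pos hσ 2)]
  have hleft (a : ℝ) : (volume : Measure (Fin N → ℂ)).map (fun v => sqNorm v / σ ^ 2) (Set.Iic a) =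
      if 0 ≤ a then ENNReal.ofReal (Real.pi ^ N * (a * σ ^ 2) ^ N / N.factorial) else 0 := by
    rw [Measure.map_apply hm measurableSet_Iic, hpre]
    split_ifs with ha
    · exact volume_sqNorm_le hN (by positivity)
    · convert measure_empty (μ := (volume : Measure (Fin N → ℂ)))
      ext v
      have h1 := sqNorm_nonneg v
      have h2 : a * σ ^ 2 < 0 := mul_neg_of_neg_of_pos (not_le.1 ha) (by positivity)
      simp only [Set.mem_ofPred_eq, Set.mem_empty_iff_false, iff_false, not_le]
      linarith
  refine ext_of_measure_Iic _ _ (fun a => ?_) fun a => ?_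
  · rw [hleft]; split_ifs <;> simp
  rw [hleft, withDensity_apply _ measurableSet_Iic, setLIntegral_indicator measurableSet_Ici,
    Set.Ici_inter_Iic]
  split_ifs with ha
  · rw [setLIntegral_Icc_const_mul_pow hN (by positivity) ha]
    congr 1
    have hf : (N.factorial : ℝ) = N * (N - 1).factorial := by
      exact_mod_cast (Nat.mul_factorial_pred (by omega)).symm
    rw [hf, mul_pow, mul_pow]
    field_simp
  · rw [Set.Icc_eq_empty ha, setLIntegral_empty]

/-- For `v` with i.i.d. `CN(0, σ²)` entries, `|v|² / σ²` has the `Gamma(N, 1)` law. -/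
lemma map_pi_complexGaussian_sqNorm_div {N : ℕ} (hN : 1 ≤ N) {σ : ℝ} (hσ : 0 < σ) :
    (Measure.pi fun _ : Fin N => complexGaussian σ).map (fun v => sqNorm v / σ ^ 2) =
      gammaMeasure N 1 := by
  have hm : Measurable fun v : Fin N → ℂ => sqNorm v / σ ^ 2 := by fun_prop
  have hsf : SigmaFinite (volume.withDensity fun z : ℂ =>
      ENNReal.ofReal (Real.exp (-(‖z‖ ^ 2 / σ ^ 2)) / (Real.pi * σ ^ 2))) := by
    rw [← complexGaussian_eq_withDensity hσ]
    have := isProbabilityMeasure_complexGaussian σ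
    infer_instance
  rw [complexGaussian_eq_withDensity hσ, pi_withDensity_fin _ (by fun_prop)]
  have hd : (fun x : Fin N → ℂ => ∏ i,
      ENNReal.ofReal (Real.exp (-(‖x i‖ ^ 2 / σ ^ 2)) / (Real.pi * σ ^ 2))) =
      fun x => (fun r : ℝ => ENNReal.ofReal (Real.exp (-r) / (Real.pi * σ ^ 2) ^ N))
        (sqNorm x / σ ^ 2) := by
    funext x
    rw [← ENNReal.ofReal_prod_of_nonneg fun i _ => by positivity, Finset.prod_div_distrib,
      ← Real.exp_sum, Finset.prod_const, Finset.card_univ, Fintype.card_fin,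
      Finset.sum_neg_distrib, ← Finset.sum_div]
    rfl
  rw [hd, withDensity_comp_map (f := fun v : Fin N → ℂ => sqNorm v / σ ^ 2)
      (g := fun r : ℝ => ENNReal.ofReal (Real.exp (-r) / (Real.pi * σ ^ 2) ^ N)) _ hm
      (by fun_prop), ← volume_pi, map_volume_sqNorm_div hN hσ,
    ← withDensity_mul _ (by measurability) (by fun_prop), gammaMeasure]
  congr 1 with r
  rw [Pi.mul_apply]
  rcases lt_or_ge r 0 with hr | hr
  · rw [Set.indicator_of_notMem (by simpa using hr), zero_mul, gammaPDF_of_neg hr]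
  · rw [Set.indicator_of_mem (by simpa using hr), gammaPDF_natCast_one hN hr,
      ← ENNReal.ofReal_mul (by positivity)]
    congr 1
    field_simp

/-! ### Estimates for independent Gamma variables -/

lemma isProbabilityMeasure_gammaMeasure_natCast {N : ℕ} (hN : 1 ≤ N) :
    IsProbabilityMeasure (gammaMeasure N 1) :=
  isProbabilityMeasure_gammaMeasure (by exact_mod_cast hN) one_pos

lemma integrable_pow_gammaMeasure {N : ℕ} (hN : 1 ≤ N) (k : ℕ) :
    Integrable (fun x : ℝ => x ^ k) (gammaMeasure N 1) := by
  have hN0 : (0 : ℝ) < N := by exact_mod_cast hN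
  rw [gammaMeasure, integrable_withDensity_iff_integrable_smul'
    (by unfold gammaPDF; fun_prop) (ae_of_all _ fun x => by simp [gammaPDF])]
  have h := ((integrable_indicator_iff measurableSet_Ioi).2
    (Real.GammaIntegral_convergent (s := (N : ℝ) + k) (by positivity))).const_mul (Real.Gamma N)⁻¹
  refine h.congr ?_
  filter_upwards [compl_mem_ae_iff.2 (measure_singleton (0 : ℝ))] with x hx
  have hx0 : x ≠ 0 := hx
  rcases lt_or_gt_of_ne hx0 with hx | hx
  · rw [Set.indicator_of_notMem (by simpa using hx.le), gammaPDF_of_neg hx]; simp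
  · rw [Set.indicator_of_mem (by simpa using hx), gammaPDF_of_nonneg hx.le,
      ENNReal.toReal_ofReal (by positivity), smul_eq_mul, Real.one_rpow, one_mul,
      add_sub_right_comm, Real.rpow_add hx, Real.rpow_natCast]
    ring

lemma integral_id_gammaMeasure {N : ℕ} (hN : 1 ≤ N) : ∫ x, x ∂(gammaMeasure N 1) = N := by
  have hN0 : (0 : ℝ) < N := by exact_mod_cast hN
  rw [gammaMeasure, integral_withDensity_eq_integral_toReal_smul
    (by unfold gammaPDF; fun_prop) (ae_of_all _ fun x => by simp [gammaPDF])]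
  have h : ∫ x in Set.Ioi (0 : ℝ), (Real.Gamma N)⁻¹ *
      (Real.exp (-x) * x ^ ((N : ℝ) + 1 - 1)) = N := by
    rw [integral_const_mul, ← Real.Gamma_eq_integral (by positivity), Real.Gamma_add_one hN0.ne']
    have := (Real.Gamma_pos_of_pos hN0).ne'
    field_simp
  refine Eq.trans ?_ h
  rw [← integral_indicator measurableSet_Ioi]
  refine integral_congr_ae ?_
  filter_upwards [compl_mem_ae_iff.2 (measure_singleton (0 : ℝ))] with x hx
  have hx0 : x ≠ 0 := hx
  rcases lt_or_gt_of_ne hx0 with hx | hx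
  · rw [Set.indicator_of_notMem (by simpa using hx.le), gammaPDF_of_neg hx]; simp
  · rw [Set.indicator_of_mem (by simpa using hx), gammaPDF_of_nonneg hx.le,
      ENNReal.toReal_ofReal (by positivity), smul_eq_mul, Real.one_rpow, one_mul,
      add_sub_right_comm, Real.rpow_add hx, Real.rpow_one]
    ring

lemma gammaMeasure_Iic_eq (N : ℕ) {x : ℝ} (hx : 0 ≤ x) :
    gammaMeasure N 1 (Set.Iic x) = ∫⁻ y in Set.Icc 0 x, gammaPDF N 1 y := by
  rw [gammaMeasure, withDensity_apply _ measurableSet_Iic,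
    lintegral_Iic_eq_lintegral_Iio_add_Icc _ hx, lintegral_gammaPDF_of_nonpos le_rfl, zero_add]

lemma gammaMeasure_Iic_le {N : ℕ} (hN : 1 ≤ N) {x : ℝ} (hx : 0 ≤ x) :
    gammaMeasure N 1 (Set.Iic x) ≤ ENNReal.ofReal (x ^ N / N.factorial) := by
  rw [gammaMeasure_Iic_eq N hx]
  have hf : (N.factorial : ℝ) = N * (N - 1).factorial := by
    exact_mod_cast (Nat.mul_factorial_pred (by omega)).symm
  have h : x ^ N / N.factorial = ((N - 1).factorial : ℝ)⁻¹ * x ^ N / N := by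
    rw [hf]; field_simp
  rw [h, ← setLIntegral_Icc_const_mul_pow hN (by positivity) hx]
  refine setLIntegral_mono (by fun_prop) fun y hy => ?_
  have hy0 := hy.1
  rw [gammaPDF_natCast_one hN hy.1, div_eq_inv_mul]
  gcongr
  exact mul_le_of_le_one_right (by positivity) (Real.exp_le_one_iff.2 (by linarith))

lemma le_gammaMeasure_Iic {N : ℕ} (hN : 1 ≤ N) {x : ℝ} (hx : 0 ≤ x) :
    ENNReal.ofReal (Real.exp (-x) * x ^ N / N.factorial) ≤ gammaMeasure N 1 (Set.Iic x) := by
  rw [gammaMeasure_Iic_eq N hx]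
  have hf : (N.factorial : ℝ) = N * (N - 1).factorial := by
    exact_mod_cast (Nat.mul_factorial_pred (by omega)).symm
  have h : Real.exp (-x) * x ^ N / N.factorial =
      (Real.exp (-x) / (N - 1).factorial) * x ^ N / N := by
    rw [hf]; field_simp
  rw [h, ← setLIntegral_Icc_const_mul_pow hN (by positivity) hx]
  refine setLIntegral_mono' measurableSet_Icc fun y hy => ?_
  have hy0 := hy.1
  rw [gammaPDF_natCast_one hN hy.1, div_mul_eq_mul_div, mul_comm]
  have := hy.2
  gcongr

lemma setLIntegral_Ioc_div {a b c : ℝ} (ha : 0 < a) (hab : a ≤ b) (hc : 0 ≤ c) :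
    ∫⁻ y in Set.Ioc a b, ENNReal.ofReal (c / y) = ENNReal.ofReal (c * Real.log (b / a)) := by
  have hb := ha.trans_le hab
  rw [← ofReal_integral_eq_lintegral_ofReal, ← intervalIntegral.integral_of_le hab]
  · simp_rw [div_eq_mul_inv c]
    rw [intervalIntegral.integral_const_mul, integral_inv_of_pos ha hb]
  · refine (ContinuousOn.integrableOn_Icc ?_).mono_set Set.Ioc_subset_Icc_self
    exact continuousOn_const.div continuousOn_id fun x hx => (ha.trans_le hx.1).ne'
  · refine (ae_restrict_iff' measurableSet_Ioc).2 (ae_of_all _ fun x hx => ?_)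
    have := ha.trans hx.1
    simp only [Pi.zero_apply]
    positivity

/-- The truncated moment `E[Y⁻ᴺ; Y > δ]` of a `Gamma(N, 1)` variable is critical, hence only
logarithmically large. -/
lemma setLIntegral_Ioi_div_pow_gammaMeasure_le {N : ℕ} (hN : 1 ≤ N) {δ : ℝ} (hδ : 0 < δ)
    (hδ1 : δ ≤ 1) :
    ∫⁻ y in Set.Ioi δ, ENNReal.ofReal ((δ / y) ^ N) ∂(gammaMeasure N 1) ≤
      ENNReal.ofReal (δ ^ N * (-Real.log δ + 1) / (N - 1).factorial) := by
  have hden : ∀ y : ℝ, 0 < y → gammaPDF N 1 y * ENNReal.ofReal ((δ / y) ^ N) =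
      ENNReal.ofReal (δ ^ N / (N - 1).factorial * (Real.exp (-y) / y)) := fun y hy => by
    rw [gammaPDF_natCast_one hN hy.le, ← ENNReal.ofReal_mul (by positivity)]
    congr 1
    obtain ⟨m, rfl⟩ : ∃ m, N = m + 1 := ⟨N - 1, by omega⟩
    rw [Nat.add_sub_cancel, div_pow]
    field_simp
    ring
  rw [gammaMeasure, restrict_withDensity measurableSet_Ioi,
    lintegral_withDensity_eq_lintegral_mul _ (by unfold gammaPDF; fun_prop) (by fun_prop),
    ← Set.Ioc_union_Ioi_eq_Ioi hδ1,
    lintegral_union measurableSet_Ioi (Set.Ioc_disjoint_Ioi le_rfl)]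
  have hlog : 0 ≤ -Real.log δ := by linarith [Real.log_nonpos hδ.le hδ1]
  have h1 : ∫⁻ y in Set.Ioc δ 1, (gammaPDF N 1 * fun y => ENNReal.ofReal ((δ / y) ^ N)) y ≤
      ENNReal.ofReal (δ ^ N / (N - 1).factorial * -Real.log δ) := by
    rw [← Real.log_inv, ← one_div, ← setLIntegral_Ioc_div hδ hδ1 (by positivity)]
    refine setLIntegral_mono (by fun_prop) fun y hy => ?_
    have hy0 := hδ.trans hy.1
    have he : Real.exp (-y) ≤ 1 := Real.exp_le_one_iff.2 (by linarith)
    rw [Pi.mul_apply, hden y hy0, ← mul_div_assoc]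
    gcongr
    exact mul_le_of_le_one_right (by positivity) he
  have h2 : ∫⁻ y in Set.Ioi 1, (gammaPDF N 1 * fun y => ENNReal.ofReal ((δ / y) ^ N)) y ≤
      ENNReal.ofReal (δ ^ N / (N - 1).factorial) := by
    calc _ ≤ ∫⁻ y in Set.Ioi (1 : ℝ),
          ENNReal.ofReal (δ ^ N / (N - 1).factorial * Real.exp (-y)) := by
          refine setLIntegral_mono (by fun_prop) fun y hy => ?_
          have hy1 : (1 : ℝ) < y := hy
          rw [Pi.mul_apply, hden y (by linarith)]
          gcongr
          exact div_le_self (by positivity) hy1.le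
      _ = ENNReal.ofReal (∫ y in Set.Ioi (1 : ℝ), δ ^ N / (N - 1).factorial * Real.exp (-y)) := by
          rw [← ofReal_integral_eq_lintegral_ofReal]
          · exact (integrableOn_exp_neg_Ioi 1).const_mul _
          · exact ae_of_all _ fun y => by simp only [Pi.zero_apply]; positivity
      _ ≤ _ := by
          rw [integral_const_mul, integral_exp_neg_Ioi]
          gcongr
          exact mul_le_of_le_one_right (by positivity) (Real.exp_le_one_iff.2 (by norm_num))
  refine (add_le_add h1 h2).trans ?_
  rw [← ENNReal.ofReal_add (by positivity) (by positivity)]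
  apply ENNReal.ofReal_le_ofReal
  apply le_of_eq
  ring

/-- Lower bound for `Pr(XY ≤ δ)`, from the range `δL < Y ≤ 1/L` with `L = -ln δ`, where both
exponential factors are at least `e^{-1/L}`. -/
lemma le_prod_gammaMeasure_mul_le {N : ℕ} (hN : 1 ≤ N) {δ L : ℝ} (hδ : 0 < δ) (hL : 0 < L)
    (hLδ : Real.log δ = -L) :
    ENNReal.ofReal (Real.exp (-2 / L) * (L - 2 * Real.log L) * δ ^ N /
        (N.factorial * (N - 1).factorial)) ≤
      (gammaMeasure N 1).prod (gammaMeasure N 1) {q | q.1 * q.2 ≤ δ} := by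
  have := isProbabilityMeasure_gammaMeasure_natCast hN
  have hms : MeasurableSet {q : ℝ × ℝ | q.1 * q.2 ≤ δ} :=
    measurableSet_le (by fun_prop) (by fun_prop)
  set c : ℝ := Real.exp (-2 / L) * δ ^ N / (N.factorial * (N - 1).factorial) with hc
  have hlog : Real.log (1 / L / (δ * L)) = L - 2 * Real.log L := by
    rw [Real.log_div (by positivity) (by positivity), Real.log_mul hδ.ne' hL.ne', one_div,
      Real.log_inv, hLδ]
    ring
  -- The logarithm of `(1 / L) / (δ L)` is `L - 2 ln L`, which is positive for every `L > 0`.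
  have hord : δ * L ≤ 1 / L := by
    have h1 : 0 < L - 2 * Real.log L := by
      have h3 := Real.log_le_sub_one_of_pos (x := L / 2) (by positivity)
      rw [Real.log_div hL.ne' two_ne_zero] at h3
      have := Real.log_two_lt_d9
      linarith
    rw [← hlog] at h1
    rw [← one_le_div (by positivity)]
    by_contra! h
    exact absurd h1 (not_lt.2 (Real.log_nonpos (by positivity) h.le))
  have key := setLIntegral_Ioc_div (c := c) (mul_pos hδ hL) hord (by positivity)
  rw [hlog] at key
  calc _ = ∫⁻ y in Set.Ioc (δ * L) (1 / L), ENNReal.ofReal (c / y) := by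
        rw [key]; congr 1; rw [hc]; ring
    _ ≤ ∫⁻ y in Set.Ioc (δ * L) (1 / L), gammaPDF N 1 y *
          gammaMeasure N 1 ((fun x => (x, y)) ⁻¹' {q : ℝ × ℝ | q.1 * q.2 ≤ δ}) := by
        refine setLIntegral_mono' measurableSet_Ioc fun y hy => ?_
        have hy0 : 0 < y := (mul_pos hδ hL).trans hy.1
        have hset : (fun x => (x, y)) ⁻¹' {q : ℝ × ℝ | q.1 * q.2 ≤ δ} = Set.Iic (δ / y) := by
          ext x; simp [le_div_iff₀ hy0]
        rw [hset]
        refine le_trans ?_ (mul_le_mul_right (le_gammaMeasure_Iic hN (by positivity)) _)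
        rw [gammaPDF_natCast_one hN hy0.le, ← ENNReal.ofReal_mul (by positivity)]
        apply ENNReal.ofReal_le_ofReal
        have h1 : δ / y ≤ 1 / L := by
          rw [div_le_div_iff₀ hy0 hL]; linarith [hy.1]
        have h2 : Real.exp (-2 / L) ≤ Real.exp (-y) * Real.exp (-(δ / y)) := by
          rw [← Real.exp_add]
          apply Real.exp_le_exp.2
          have : -2 / L = -(1 / L) + -(1 / L) := by ring
          linarith [hy.2]
        have h3 : y ^ (N - 1) * Real.exp (-y) / (N - 1).factorial *
            (Real.exp (-(δ / y)) * (δ / y) ^ N / N.factorial) =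
            (Real.exp (-y) * Real.exp (-(δ / y))) * δ ^ N /
              (N.factorial * (N - 1).factorial) / y := by
          obtain ⟨m, rfl⟩ : ∃ m, N = m + 1 := ⟨N - 1, by omega⟩
          rw [Nat.add_sub_cancel, div_pow]
          field_simp
          ring
        rw [h3, hc]
        gcongr
    _ ≤ ∫⁻ y, gammaPDF N 1 y *
          gammaMeasure N 1 ((fun x => (x, y)) ⁻¹' {q : ℝ × ℝ | q.1 * q.2 ≤ δ}) :=
        setLIntegral_le_lintegral _ _
    _ = _ := by
        rw [Measure.prod_apply_symm hms]
        conv_rhs => rw [gammaMeasure]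
        rw [lintegral_withDensity_eq_lintegral_mul _ (by unfold gammaPDF; fun_prop)
          (measurable_measure_prodMk_right hms)]
        rfl

/-- Follows from comparing `u` with `η v`; a weighted substitute for the binomial expansion. -/
lemma add_pow_le_weighted {u v η : ℝ} (hu : 0 ≤ u) (hv : 0 ≤ v) (hη : 0 < η) (N : ℕ) :
    (u + v) ^ N ≤ (1 + η) ^ N * v ^ N + (1 + 1 / η) ^ N * u ^ N := by
  rw [← mul_pow, ← mul_pow]
  rcases le_total u (η * v) with h | h
  · have : (u + v) ^ N ≤ ((1 + η) * v) ^ N := by gcongr; linarith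
    have : 0 ≤ ((1 + 1 / η) * u) ^ N := by positivity
    linarith
  · have h' : v ≤ 1 / η * u := by rw [one_div, ← div_eq_inv_mul, le_div_iff₀ hη]; linarith
    have : (u + v) ^ N ≤ ((1 + 1 / η) * u) ^ N := by gcongr; linarith
    have : 0 ≤ ((1 + η) * v) ^ N := by positivity
    linarith

lemma integrable_affine_pow_gammaMeasure {N : ℕ} (hN : 1 ≤ N) {ρ : ℝ} (hρ : 0 ≤ ρ) (k : ℕ) :
    Integrable (fun z : ℝ => (ρ * |z| + 1) ^ k) (gammaMeasure N 1) := by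
  have := isProbabilityMeasure_gammaMeasure_natCast hN
  refine Integrable.mono' (((integrable_pow_gammaMeasure hN k).norm.const_mul
    (2 ^ k * ρ ^ k)).add (integrable_const (2 ^ k))) (by fun_prop) (ae_of_all _ fun z => ?_)
  rw [Real.norm_of_nonneg (by positivity), Pi.add_apply, norm_pow, Real.norm_eq_abs]
  have h := add_pow_le_weighted (by positivity : 0 ≤ ρ * |z|) zero_le_one one_pos k
  rw [mul_pow] at h
  norm_num at h
  linarith

/-- Upper bound for `Pr(X ≤ ε (ρ Z + 1) + δ / Y)`, with the event multiplied out by `Y` so that it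
also makes sense for `Y = 0`. The interference
enters only through the last term, which carries no logarithm; `η` is a free weight. -/
lemma prod_gammaMeasure_le {N : ℕ} (hN : 1 ≤ N) {δ ε η ρ : ℝ} (hδ : 0 < δ) (hδ1 : δ ≤ 1)
    (hε : 0 < ε) (hη : 0 < η) (hρ : 0 ≤ ρ) :
    (gammaMeasure N 1).prod ((gammaMeasure N 1).prod (gammaMeasure N 1))
        {q | q.1 * q.2.2 ≤ ε * q.2.2 * (ρ * q.2.1 + 1) + δ} ≤
      ENNReal.ofReal (δ ^ N / N.factorial +
        (1 + η) ^ N / N.factorial * (δ ^ N * (-Real.log δ + 1) / (N - 1).factorial) +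
        (1 + 1 / η) ^ N * ε ^ N / N.factorial *
          ∫ z, (ρ * |z| + 1) ^ N ∂(gammaMeasure N 1)) := by
  have := isProbabilityMeasure_gammaMeasure_natCast hN
  have hlog : 0 ≤ -Real.log δ := by linarith [Real.log_nonpos hδ.le hδ1]
  set T : Set (ℝ × ℝ × ℝ) := {q | q.1 * q.2.2 ≤ ε * q.2.2 * (ρ * q.2.1 + 1) + δ} with hT
  have hms : MeasurableSet T := measurableSet_le (by fun_prop) (by fun_prop)
  set F₁ : ℝ → ENNReal := (Set.Iic δ).indicator 1 with hF₁
  set F₂ : ℝ → ENNReal := fun y => ENNReal.ofReal ((1 + η) ^ N / N.factorial) *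
    (Set.Ioi δ).indicator (fun y => ENNReal.ofReal ((δ / y) ^ N)) y with hF₂
  set F₃ : ℝ → ENNReal := fun z => ENNReal.ofReal ((1 + 1 / η) ^ N * ε ^ N / N.factorial *
    (ρ * |z| + 1) ^ N) with hF₃
  have hm₁ : Measurable F₁ := measurable_one.indicator measurableSet_Iic
  have hm₂ : Measurable F₂ :=
    measurable_const.mul (Measurable.indicator (by fun_prop) measurableSet_Ioi)
  have hm₃ : Measurable F₃ := by fun_prop
  have hslice : ∀ q : ℝ × ℝ, gammaMeasure N 1 ((fun x => (x, q)) ⁻¹' T) ≤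
      (F₁ q.2 + F₂ q.2) + F₃ q.1 := by
    rintro ⟨z, y⟩
    rcases le_or_gt y δ with hy | hy
    · calc _ ≤ (1 : ENNReal) := prob_le_one
        _ = F₁ y := by simp [hF₁, hy]
        _ ≤ _ := by rw [add_assoc]; exact le_self_add
    · have hy0 := hδ.trans hy
      have hsub : (fun x => (x, (z, y))) ⁻¹' T ⊆ Set.Iic (ε * (ρ * |z| + 1) + δ / y) := by
        intro x hx
        have hx' : x * y ≤ ε * y * (ρ * z + 1) + δ := hx
        rw [Set.mem_Iic, ← mul_le_mul_iff_left₀ hy0, add_mul, div_mul_cancel₀ _ hy0.ne']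
        have : ε * y * (ρ * z + 1) ≤ ε * y * (ρ * |z| + 1) := by
          gcongr; exact le_abs_self z
        linarith
      refine (measure_mono hsub).trans ((gammaMeasure_Iic_le hN (by positivity)).trans ?_)
      have hF1 : F₁ y = 0 := by simp [hF₁, hy]
      have hF2 : F₂ y = ENNReal.ofReal ((1 + η) ^ N / N.factorial * (δ / y) ^ N) := by
        simp only [hF₂]
        rw [Set.indicator_of_mem (by simpa using hy), ← ENNReal.ofReal_mul (by positivity)]
      simp only
      rw [hF1, zero_add, hF2, ← ENNReal.ofReal_add (by positivity) (by positivity)]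
      apply ENNReal.ofReal_le_ofReal
      have h := add_pow_le_weighted (by positivity : 0 ≤ ε * (ρ * |z| + 1))
        (by positivity : 0 ≤ δ / y) hη N
      rw [mul_pow ε] at h
      calc _ ≤ ((1 + η) ^ N * (δ / y) ^ N + (1 + 1 / η) ^ N * (ε ^ N * (ρ * |z| + 1) ^ N)) /
            N.factorial := by gcongr
        _ = _ := by ring
  have hi₁ : ∫⁻ q : ℝ × ℝ, F₁ q.2 ∂((gammaMeasure N 1).prod (gammaMeasure N 1)) ≤
      ENNReal.ofReal (δ ^ N / N.factorial) := by
    rw [measurePreserving_snd.lintegral_comp hm₁, hF₁, lintegral_indicator_one measurableSet_Iic]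
    exact gammaMeasure_Iic_le hN hδ.le
  have hi₂ : ∫⁻ q : ℝ × ℝ, F₂ q.2 ∂((gammaMeasure N 1).prod (gammaMeasure N 1)) ≤
      ENNReal.ofReal ((1 + η) ^ N / N.factorial *
        (δ ^ N * (-Real.log δ + 1) / (N - 1).factorial)) := by
    rw [measurePreserving_snd.lintegral_comp hm₂, hF₂, lintegral_const_mul _
      (Measurable.indicator (by fun_prop) measurableSet_Ioi), lintegral_indicator measurableSet_Ioi,
      ENNReal.ofReal_mul (by positivity)]
    gcongr
    exact setLIntegral_Ioi_div_pow_gammaMeasure_le hN hδ hδ1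
  have hi₃ : ∫⁻ q : ℝ × ℝ, F₃ q.1 ∂((gammaMeasure N 1).prod (gammaMeasure N 1)) =
      ENNReal.ofReal ((1 + 1 / η) ^ N * ε ^ N / N.factorial *
          ∫ z, (ρ * |z| + 1) ^ N ∂(gammaMeasure N 1)) := by
    rw [measurePreserving_fst.lintegral_comp hm₃, hF₃, ← integral_const_mul,
      ofReal_integral_eq_lintegral_ofReal
        ((integrable_affine_pow_gammaMeasure hN hρ N).const_mul _)
        (ae_of_all _ fun z => by simp only [Pi.zero_apply]; positivity)]
  have hC : 0 ≤ ∫ z, (ρ * |z| + 1) ^ N ∂(gammaMeasure N 1) :=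
    integral_nonneg fun z => by simp only [Pi.zero_apply]; positivity
  rw [Measure.prod_apply_symm hms]
  refine (lintegral_mono hslice).trans ?_
  rw [lintegral_add_left (by fun_prop), lintegral_add_left (by fun_prop), hi₃,
    ENNReal.ofReal_add (by positivity) (by positivity),
    ENNReal.ofReal_add (by positivity) (by positivity)]
  gcongr

/-! ### Reduction of the outage event to Gamma variables -/

lemma star_dotProduct_self_eq_sqNorm {N : ℕ} (v : Fin N → ℂ) : star v ⬝ᵥ v = (sqNorm v : ℂ) := by
  simp only [dotProduct, sqNorm, Pi.star_apply, RCLike.star_def, Complex.ofReal_sum,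
    Complex.conj_mul', Complex.ofReal_pow]

lemma norm_star_dotProduct_sq_le {N : ℕ} (v u : Fin N → ℂ) :
    ‖star v ⬝ᵥ u‖ ^ 2 ≤ sqNorm v * sqNorm u := by
  have h : ‖star v ⬝ᵥ u‖ ≤ ∑ i, ‖v i‖ * ‖u i‖ :=
    (norm_sum_le _ _).trans_eq (Finset.sum_congr rfl fun i _ => by simp)
  calc _ ≤ (∑ i, ‖v i‖ * ‖u i‖) ^ 2 := by gcongr
    _ ≤ _ := Finset.sum_mul_sq_le_sq_mul_sq _ _ _

lemma integrable_sqNorm_pi_complexGaussian {N : ℕ} (hN : 1 ≤ N) {σ : ℝ} (hσ : 0 < σ) :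
    Integrable (sqNorm : (Fin N → ℂ) → ℝ) (Measure.pi fun _ => complexGaussian σ) := by
  have h := integrable_pow_gammaMeasure hN 1
  simp only [pow_one] at h
  rw [← map_pi_complexGaussian_sqNorm_div hN hσ, integrable_map_measure (by fun_prop)
    (by fun_prop)] at h
  refine (h.const_mul (σ ^ 2)).congr (ae_of_all _ fun v => ?_)
  simp only [Function.comp]
  field_simp

lemma integral_sqNorm_pi_complexGaussian {N : ℕ} (hN : 1 ≤ N) {σ : ℝ} (hσ : 0 < σ) :
    ∫ v : Fin N → ℂ, sqNorm v ∂(Measure.pi fun _ => complexGaussian σ) = N * σ ^ 2 := by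
  have h := integral_id_gammaMeasure hN
  rw [← map_pi_complexGaussian_sqNorm_div hN hσ, integral_map (by fun_prop) (by fun_prop),
    integral_div, div_eq_iff (by positivity)] at h
  exact h

namespace RelayParams

variable (p : RelayParams) {N : ℕ}

lemma isProbabilityMeasure_channelLaw (N : ℕ) : IsProbabilityMeasure (p.channelLaw N) := by
  have := isProbabilityMeasure_complexGaussian
  unfold channelLaw
  infer_instance

/-- The integrand of `meanCombinedPower`. -/
def combinedPower (h : Channels N) : ℝ :=
  sqNorm h.1 * p.P + ‖star h.1 ⬝ᵥ h.2.1‖ ^ 2 * p.PI / sqNorm h.1 + p.N₀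

lemma combinedPower_ge (h : Channels N) : sqNorm h.1 * p.P + p.N₀ ≤ p.combinedPower h := by
  have h1 := sqNorm_nonneg h.1
  have h2 := p.PI_pos
  have : 0 ≤ ‖star h.1 ⬝ᵥ h.2.1‖ ^ 2 * p.PI / sqNorm h.1 := by positivity
  unfold combinedPower
  linarith

lemma combinedPower_le (h : Channels N) :
    p.combinedPower h ≤ sqNorm h.1 * p.P + sqNorm h.2.1 * p.PI + p.N₀ := by
  have h2 := p.PI_pos
  have h3 : ‖star h.1 ⬝ᵥ h.2.1‖ ^ 2 * p.PI / sqNorm h.1 ≤ sqNorm h.2.1 * p.PI := by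
    refine div_le_of_le_mul₀ (sqNorm_nonneg _) (mul_nonneg (sqNorm_nonneg _) h2.le) ?_
    have := mul_le_mul_of_nonneg_right (norm_star_dotProduct_sq_le h.1 h.2.1) h2.le
    linarith
  unfold combinedPower
  linarith

@[fun_prop]
lemma measurable_combinedPower : Measurable (p.combinedPower : Channels N → ℝ) := by
  unfold combinedPower dotProduct
  simp only [Pi.star_apply, RCLike.star_def]
  fun_prop

/-- The mean combined power lies between its value without interference and the value obtained
by bounding `|h₁†h_I|² / |h₁|²` by `|h_I|²`; both are integrable, so the defining integral is
not a junk value. -/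
lemma meanCombinedPower_mem_Icc (hN : 1 ≤ N) :
    p.meanCombinedPower N ∈ Set.Icc (N * p.σ₁ ^ 2 * p.P + p.N₀)
      (N * p.σ₁ ^ 2 * p.P + N * p.σI ^ 2 * p.PI + p.N₀) := by
  have hprob := p.isProbabilityMeasure_channelLaw N
  have := isProbabilityMeasure_complexGaussian
  have mp₁ : MeasurePreserving Prod.fst (p.channelLaw N)
      (Measure.pi fun _ : Fin N => complexGaussian p.σ₁) := measurePreserving_fst
  have mp₂ : MeasurePreserving (fun h : Channels N => h.2.1) (p.channelLaw N)
      (Measure.pi fun _ : Fin N => complexGaussian p.σI) :=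
    measurePreserving_fst.comp measurePreserving_snd
  have i₁ : Integrable (fun h : Channels N => sqNorm h.1 * p.P) (p.channelLaw N) :=
    (mp₁.integrable_comp_of_integrable
      (integrable_sqNorm_pi_complexGaussian hN p.σ₁_pos)).mul_const _
  have i₂ : Integrable (fun h : Channels N => sqNorm h.2.1 * p.PI) (p.channelLaw N) :=
    (mp₂.integrable_comp_of_integrable
      (integrable_sqNorm_pi_complexGaussian hN p.σI_pos)).mul_const _
  have e₁ : ∫ h : Channels N, sqNorm h.1 * p.P ∂(p.channelLaw N) = N * p.σ₁ ^ 2 * p.P := by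
    rw [integral_mul_const, ← integral_sqNorm_pi_complexGaussian hN p.σ₁_pos, ← mp₁.map_eq,
      integral_map mp₁.measurable.aemeasurable (by fun_prop)]
  have e₂ : ∫ h : Channels N, sqNorm h.2.1 * p.PI ∂(p.channelLaw N) = N * p.σI ^ 2 * p.PI := by
    rw [integral_mul_const, ← integral_sqNorm_pi_complexGaussian hN p.σI_pos, ← mp₂.map_eq,
      integral_map mp₂.measurable.aemeasurable (by fun_prop)]
  have ic : Integrable (fun _ : Channels N => p.N₀) (p.channelLaw N) := integrable_const _
  have i₃ : Integrable (p.combinedPower : Channels N → ℝ) (p.channelLaw N) := by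
    refine ((i₁.add i₂).add ic).mono' (by fun_prop) (ae_of_all _ fun h => ?_)
    rw [Real.norm_of_nonneg]
    · exact p.combinedPower_le h
    · have := mul_nonneg (sqNorm_nonneg h.1) p.P_pos.le
      linarith [p.combinedPower_ge h, p.N₀_pos]
  constructor
  · calc _ = ∫ h : Channels N, (sqNorm h.1 * p.P + p.N₀) ∂(p.channelLaw N) := by
          rw [integral_add i₁ ic, e₁]; simp
      _ ≤ _ := integral_mono (i₁.add ic) i₃ p.combinedPower_ge
  · calc _ ≤ ∫ h : Channels N, (sqNorm h.1 * p.P + sqNorm h.2.1 * p.PI + p.N₀)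
            ∂(p.channelLaw N) := integral_mono i₃ ((i₁.add i₂).add ic) p.combinedPower_le
      _ = _ := by
          have h₁₂ := integral_add i₁ i₂
          rw [e₁, e₂] at h₁₂
          have h := integral_add (i₁.add i₂) ic
          simp only [Pi.add_apply] at h
          rw [h, h₁₂]
          simp

lemma meanCombinedPower_pos (hN : 1 ≤ N) : 0 < p.meanCombinedPower N := by
  have h := (p.meanCombinedPower_mem_Icc hN).1
  have := p.N₀_pos
  have : 0 ≤ N * p.σ₁ ^ 2 * p.P := by have := p.P_pos; positivity
  linarith

/-- The real scalar in front of `h₂ h₁†` in the relay matrix. -/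
def relayScale (h : Channels N) : ℝ := p.gainNoICI N / (√(sqNorm h.2.2) * √(sqNorm h.1))

lemma relayScale_sq (h : Channels N) :
    p.relayScale h ^ 2 = p.gainNoICI N ^ 2 / (sqNorm h.2.2 * sqNorm h.1) := by
  rw [relayScale, div_pow, mul_pow, Real.sq_sqrt (sqNorm_nonneg _), Real.sq_sqrt (sqNorm_nonneg _)]

/-- An inequality because of the convention `w / 0 = 0` when a channel vector vanishes. -/
lemma relayScale_sq_mul_le (h : Channels N) :
    p.relayScale h ^ 2 * (sqNorm h.2.2 * sqNorm h.1) ≤ p.gainNoICI N ^ 2 := by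
  rw [relayScale_sq]
  rcases eq_or_ne (sqNorm h.2.2 * sqNorm h.1) 0 with h0 | h0
  · rw [h0, mul_zero]; positivity
  · rw [div_mul_cancel₀ _ h0]

lemma dotProduct_relayMatrix_mulVec (h : Channels N) (v : Fin N → ℂ) :
    star h.2.2 ⬝ᵥ (p.relayMatrixNoICI h *ᵥ v) =
      (p.relayScale h : ℂ) * ((sqNorm h.2.2 : ℂ) * (star h.1 ⬝ᵥ v)) := by
  rw [relayMatrixNoICI, Matrix.smul_mulVec, dotProduct_smul, Matrix.vecMulVec_mulVec,
    ← star_dotProduct_self_eq_sqNorm]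
  simp [relayScale, mul_comm]

lemma norm_dotProduct_relayMatrix_mulVec_sq (h : Channels N) (v : Fin N → ℂ) :
    ‖star h.2.2 ⬝ᵥ (p.relayMatrixNoICI h *ᵥ v)‖ ^ 2 =
      p.relayScale h ^ 2 * sqNorm h.2.2 ^ 2 * ‖star h.1 ⬝ᵥ v‖ ^ 2 := by
  rw [dotProduct_relayMatrix_mulVec, norm_mul, norm_mul, mul_pow, mul_pow, Complex.norm_real,
    Complex.norm_real, Real.norm_eq_abs, Real.norm_eq_abs, sq_abs, sq_abs, mul_assoc]

lemma signal_gain (h : Channels N) :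
    ‖star h.2.2 ⬝ᵥ (p.relayMatrixNoICI h *ᵥ h.1)‖ ^ 2 =
      p.gainNoICI N ^ 2 * (sqNorm h.2.2 * sqNorm h.1) := by
  rw [norm_dotProduct_relayMatrix_mulVec_sq, star_dotProduct_self_eq_sqNorm, Complex.norm_real,
    Real.norm_eq_abs, sq_abs, relayScale_sq]
  rcases eq_or_ne (sqNorm h.2.2 * sqNorm h.1) 0 with h0 | h0
  · rw [h0]; simp
  · have := left_ne_zero_of_mul h0
    have := right_ne_zero_of_mul h0
    field_simp

lemma interference_gain_le (h : Channels N) :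
    ‖star h.2.2 ⬝ᵥ (p.relayMatrixNoICI h *ᵥ h.2.1)‖ ^ 2 ≤
      p.gainNoICI N ^ 2 * (sqNorm h.2.2 * sqNorm h.2.1) := by
  have h2 := sqNorm_nonneg h.2.2
  have hI := sqNorm_nonneg h.2.1
  rw [norm_dotProduct_relayMatrix_mulVec_sq]
  calc _ ≤ p.relayScale h ^ 2 * sqNorm h.2.2 ^ 2 * (sqNorm h.1 * sqNorm h.2.1) := by
        gcongr; exact norm_star_dotProduct_sq_le _ _
    _ = p.relayScale h ^ 2 * (sqNorm h.2.2 * sqNorm h.1) * (sqNorm h.2.2 * sqNorm h.2.1) := by ring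
    _ ≤ _ := by gcongr; exact p.relayScale_sq_mul_le h

lemma noise_gain_le (h : Channels N) :
    sqNorm (star h.2.2 ᵥ* p.relayMatrixNoICI h) ≤ p.gainNoICI N ^ 2 * sqNorm h.2.2 := by
  have h2 := sqNorm_nonneg h.2.2
  have hv : star h.2.2 ᵥ* p.relayMatrixNoICI h =
      ((p.relayScale h * sqNorm h.2.2 : ℝ) : ℂ) • star h.1 := by
    rw [relayMatrixNoICI, Matrix.vecMul_smul, Matrix.vecMul_vecMulVec,
      star_dotProduct_self_eq_sqNorm, Complex.ofReal_mul, mul_smul]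
    rfl
  have hs : sqNorm (star h.2.2 ᵥ* p.relayMatrixNoICI h) =
      (p.relayScale h * sqNorm h.2.2) ^ 2 * sqNorm h.1 := by
    rw [hv]
    simp only [sqNorm, Pi.smul_apply, Pi.star_apply, norm_smul, mul_pow, norm_star,
      Complex.norm_real, Real.norm_eq_abs, sq_abs, ← Finset.mul_sum]
  rw [hs]
  calc _ = p.relayScale h ^ 2 * (sqNorm h.2.2 * sqNorm h.1) * sqNorm h.2.2 := by ring
    _ ≤ _ := by gcongr; exact p.relayScale_sq_mul_le h

/-- The normalized squared norms `(|h₁|² / σ₁², |h_I|² / σ_I², |h₂|² / σ₂²)`. -/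
def normalizedSqNorms (h : Channels N) : ℝ × ℝ × ℝ :=
  (sqNorm h.1 / p.σ₁ ^ 2, sqNorm h.2.1 / p.σI ^ 2, sqNorm h.2.2 / p.σ₂ ^ 2)

@[fun_prop]
lemma measurable_normalizedSqNorms :
    Measurable (p.normalizedSqNorms : Channels N → ℝ × ℝ × ℝ) := by
  unfold normalizedSqNorms
  fun_prop

lemma map_channelLaw_normalizedSqNorms (hN : 1 ≤ N) :
    (p.channelLaw N).map p.normalizedSqNorms =
      (gammaMeasure N 1).prod ((gammaMeasure N 1).prod (gammaMeasure N 1)) := by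
  have := isProbabilityMeasure_complexGaussian
  have := isProbabilityMeasure_gammaMeasure_natCast hN
  have mp {σ : ℝ} (hσ : 0 < σ) : MeasurePreserving (fun v : Fin N → ℂ => sqNorm v / σ ^ 2)
      (Measure.pi fun _ => complexGaussian σ) (gammaMeasure N 1) :=
    ⟨by fun_prop, map_pi_complexGaussian_sqNorm_div hN hσ⟩
  exact ((mp p.σ₁_pos).prod ((mp p.σI_pos).prod (mp p.σ₂_pos))).map_eq

/-- The threshold `δ = γ_th E{⋯} / (N₀ ρ₁ ρ₂)` such that, interference and relay noise apart,
outage means `|h₁|² |h₂|² ≤ δ σ₁² σ₂²`. -/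
def productThreshold (N : ℕ) (γth : ℝ) : ℝ :=
  γth * (p.meanCombinedPower N / p.N₀) / (p.ρ₁ * p.ρ₂)

lemma ρ₁_pos : 0 < p.ρ₁ := by
  have := p.P_pos; have := p.σ₁_pos; have := p.N₀_pos
  unfold ρ₁; positivity

lemma ρ₂_pos : 0 < p.ρ₂ := by
  have := p.Pr_pos; have := p.σ₂_pos; have := p.N₀_pos
  unfold ρ₂; positivity

lemma ρI_pos : 0 < p.ρI := by
  have := p.PI_pos; have := p.σI_pos; have := p.N₀_pos
  unfold ρI; positivity

lemma gainNoICI_sq (hN : 1 ≤ N) : p.gainNoICI N ^ 2 = p.Pr / p.meanCombinedPower N :=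
  Real.sq_sqrt (div_nonneg p.Pr_pos.le (p.meanCombinedPower_pos hN).le)

lemma gainNoICI_sq_mul (hN : 1 ≤ N) {γth : ℝ} (hγ : 0 < γth) (x y : ℝ) :
    p.gainNoICI N ^ 2 * (y * x) * p.P =
      γth * p.N₀ / p.productThreshold N γth * (x / p.σ₁ ^ 2 * (y / p.σ₂ ^ 2)) := by
  have := p.meanCombinedPower_pos hN
  have := p.P_pos; have := p.σ₁_pos; have := p.N₀_pos; have := p.Pr_pos; have := p.σ₂_pos
  rw [p.gainNoICI_sq hN, productThreshold, ρ₁, ρ₂]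
  field_simp

lemma productThreshold_pos (hN : 1 ≤ N) {γth : ℝ} (hγ : 0 < γth) :
    0 < p.productThreshold N γth := by
  have := p.meanCombinedPower_pos hN
  have := p.N₀_pos; have := p.ρ₁_pos; have := p.ρ₂_pos
  unfold productThreshold; positivity

lemma sinr_le_of_mul_le (hN : 1 ≤ N) {γth : ℝ} (hγ : 0 < γth) {h : Channels N}
    (hh : (p.normalizedSqNorms h).1 * (p.normalizedSqNorms h).2.2 ≤ p.productThreshold N γth) :
    p.sinr (p.relayMatrixNoICI h) h ≤ γth := by
  have hδ := p.productThreshold_pos hN hγ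
  have hN₀ := p.N₀_pos
  have hI : 0 ≤ ‖star h.2.2 ⬝ᵥ (p.relayMatrixNoICI h *ᵥ h.2.1)‖ ^ 2 * p.PI :=
    mul_nonneg (sq_nonneg _) p.PI_pos.le
  have hn : 0 ≤ sqNorm (star h.2.2 ᵥ* p.relayMatrixNoICI h) * p.N₀ :=
    mul_nonneg (sqNorm_nonneg _) hN₀.le
  rw [sinr, div_le_iff₀ (by linarith), signal_gain, gainNoICI_sq_mul p hN hγ]
  calc _ ≤ γth * p.N₀ / p.productThreshold N γth * p.productThreshold N γth := by
        gcongr; exact hh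
    _ = γth * p.N₀ := by field_simp
    _ ≤ _ := by gcongr; linarith

lemma mul_le_of_sinr_le (hN : 1 ≤ N) {γth : ℝ} (hγ : 0 < γth) {h : Channels N}
    (hh : p.sinr (p.relayMatrixNoICI h) h ≤ γth) :
    (p.normalizedSqNorms h).1 * (p.normalizedSqNorms h).2.2 ≤
      γth / p.ρ₁ * (p.normalizedSqNorms h).2.2 * (p.ρI * (p.normalizedSqNorms h).2.1 + 1) +
        p.productThreshold N γth := by
  have hδ := p.productThreshold_pos hN hγ
  have hN₀ := p.N₀_pos
  have hPI := p.PI_pos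
  have hI : 0 ≤ ‖star h.2.2 ⬝ᵥ (p.relayMatrixNoICI h *ᵥ h.2.1)‖ ^ 2 * p.PI :=
    mul_nonneg (sq_nonneg _) p.PI_pos.le
  have hn : 0 ≤ sqNorm (star h.2.2 ᵥ* p.relayMatrixNoICI h) * p.N₀ :=
    mul_nonneg (sqNorm_nonneg _) hN₀.le
  rw [sinr, div_le_iff₀ (by linarith), signal_gain, gainNoICI_sq_mul p hN hγ] at hh
  have hle : γth * p.N₀ / p.productThreshold N γth *
      ((p.normalizedSqNorms h).1 * (p.normalizedSqNorms h).2.2) ≤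
      γth * (p.gainNoICI N ^ 2 * (sqNorm h.2.2 * sqNorm h.2.1) * p.PI +
        p.gainNoICI N ^ 2 * sqNorm h.2.2 * p.N₀ + p.N₀) := by
    refine hh.trans ?_
    gcongr
    · exact p.interference_gain_le h
    · exact p.noise_gain_le h
  have hfac : 0 < γth * p.N₀ / p.productThreshold N γth := by positivity
  refine le_of_mul_le_mul_left (hle.trans_eq ?_) hfac
  have := p.meanCombinedPower_pos hN
  have := p.P_pos; have := p.σ₁_pos; have := p.Pr_pos; have := p.σ₂_pos; have := p.σI_pos
  simp only [normalizedSqNorms]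
  rw [p.gainNoICI_sq hN, productThreshold, ρ₁, ρ₂, ρI]
  field_simp

lemma le_outageNoICI (hN : 1 ≤ N) {γth L : ℝ} (hγ : 0 < γth) (hL : 0 < L)
    (hLδ : Real.log (p.productThreshold N γth) = -L) :
    Real.exp (-2 / L) * (L - 2 * Real.log L) * p.productThreshold N γth ^ N /
      (N.factorial * (N - 1).factorial) ≤ p.outageNoICI N γth := by
  have hprob := p.isProbabilityMeasure_channelLaw N
  have := isProbabilityMeasure_gammaMeasure_natCast hN
  refine (ENNReal.ofReal_le_iff_le_toReal (measure_ne_top _ _)).1 ?_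
  have hms : MeasurableSet {q : ℝ × ℝ | q.1 * q.2 ≤ p.productThreshold N γth} :=
    measurableSet_le (by fun_prop) (by fun_prop)
  have mp : MeasurePreserving (Prod.map id Prod.snd : ℝ × ℝ × ℝ → ℝ × ℝ)
      ((gammaMeasure N 1).prod ((gammaMeasure N 1).prod (gammaMeasure N 1)))
      ((gammaMeasure N 1).prod (gammaMeasure N 1)) :=
    (MeasurePreserving.id _).prod measurePreserving_snd
  refine (le_prod_gammaMeasure_mul_le hN (p.productThreshold_pos hN hγ) hL hLδ).trans ?_
  rw [← mp.map_eq, Measure.map_apply mp.measurable hms, ← p.map_channelLaw_normalizedSqNorms hN,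
    Measure.map_apply p.measurable_normalizedSqNorms (mp.measurable hms)]
  exact measure_mono fun h hh => p.sinr_le_of_mul_le hN hγ hh

lemma outageNoICI_le (hN : 1 ≤ N) {γth η : ℝ} (hγ : 0 < γth) (hη : 0 < η)
    (hδ : p.productThreshold N γth ≤ 1) :
    p.outageNoICI N γth ≤ p.productThreshold N γth ^ N / N.factorial +
        (1 + η) ^ N / N.factorial * (p.productThreshold N γth ^ N *
          (-Real.log (p.productThreshold N γth) + 1) / (N - 1).factorial) +
        (1 + 1 / η) ^ N * (γth / p.ρ₁) ^ N / N.factorial *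
          ∫ z, (p.ρI * |z| + 1) ^ N ∂(gammaMeasure N 1) := by
  have hprob := p.isProbabilityMeasure_channelLaw N
  have hδ0 := p.productThreshold_pos hN hγ
  have hρ₁ := p.ρ₁_pos
  have hρI := p.ρI_pos
  have hlog : 0 ≤ -Real.log (p.productThreshold N γth) := by
    linarith [Real.log_nonpos hδ0.le hδ]
  have hC : 0 ≤ ∫ z, (p.ρI * |z| + 1) ^ N ∂(gammaMeasure N 1) :=
    integral_nonneg fun z => by simp only [Pi.zero_apply]; positivity
  refine ENNReal.toReal_le_of_le_ofReal (by positivity) (le_trans ?_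
    (prod_gammaMeasure_le hN hδ0 hδ (by positivity) hη hρI.le))
  rw [← p.map_channelLaw_normalizedSqNorms hN, Measure.map_apply p.measurable_normalizedSqNorms
    (measurableSet_le (by fun_prop) (by fun_prop))]
  exact measure_mono fun h hh => p.mul_le_of_sinr_le hN hγ hh

end RelayParams

/-! ### High-SNR asymptotics -/

lemma tendsto_lower_factor :
    Tendsto (fun L : ℝ => Real.exp (-2 / L) * (1 - 2 * (Real.log L / L))) atTop (𝓝 1) := by
  have h1 : Tendsto (fun L : ℝ => Real.exp (-2 / L)) atTop (𝓝 (Real.exp 0)) :=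
    (Real.continuous_exp.tendsto 0).comp (tendsto_const_nhds.div_atTop tendsto_id)
  have h2 : Tendsto (fun L : ℝ => Real.log L / L) atTop (𝓝 0) :=
    Real.isLittleO_log_id_atTop.tendsto_div_nhds_zero
  simpa using h1.mul ((h2.const_mul 2).const_sub 1)

lemma tendsto_one_add_log_pow_div (N : ℕ) :
    Tendsto (fun L : ℝ => (1 + Real.log L) ^ N / L) atTop (𝓝 0) := by
  have h := (Real.isLittleO_pow_log_id_atTop (n := N)).tendsto_div_nhds_zero.comp
    (tendsto_id.const_mul_atTop (Real.exp_pos 1))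
  have h' := h.const_mul (Real.exp 1)
  rw [mul_zero] at h'
  refine h'.congr' ?_
  filter_upwards [eventually_gt_atTop 0] with L hL
  simp only [Function.comp, id]
  rw [Real.log_mul (Real.exp_pos 1).ne' hL.ne', Real.log_exp]
  have := Real.exp_pos 1
  field_simp

lemma tendsto_upper_factor (N : ℕ) (A B : ℝ) :
    Tendsto (fun L : ℝ => A / L + (1 + 1 / Real.log L) ^ N * (1 + 1 / L) +
      B * ((1 + Real.log L) ^ N / L)) atTop (𝓝 1) := by
  have h1 : Tendsto (fun L : ℝ => A / L) atTop (𝓝 0) := tendsto_const_nhds.div_atTop tendsto_id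
  have h2 : Tendsto (fun L : ℝ => 1 / L) atTop (𝓝 0) := tendsto_const_nhds.div_atTop tendsto_id
  have h3 : Tendsto (fun L : ℝ => 1 / Real.log L) atTop (𝓝 0) :=
    tendsto_const_nhds.div_atTop Real.tendsto_log_atTop
  simpa using (h1.add (((h3.const_add 1).pow N).mul (h2.const_add 1))).add
    ((tendsto_one_add_log_pow_div N).const_mul B)

lemma sum_alternating_inv_Gamma {N : ℕ} (hN : 1 ≤ N) :
    ∑ i ∈ Finset.range N, (-1 : ℝ) ^ (N - i) /
      (Real.Gamma N * Real.Gamma ((i : ℝ) + 1) * Real.Gamma ((N : ℝ) - i + 1)) =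
      -1 / (N.factorial * (N - 1).factorial) := by
  have hG : Real.Gamma N = (N - 1).factorial := by
    rw [← Real.Gamma_nat_eq_factorial, Nat.cast_sub hN, Nat.cast_one, sub_add_cancel]
  have hb : ∑ i ∈ Finset.range N, (-1 : ℝ) ^ (N - i) * (N.choose i : ℝ) = -1 := by
    have h := add_pow (1 : ℝ) (-1) N
    rw [add_neg_cancel, zero_pow (by omega), Finset.sum_range_succ] at h
    simp only [one_pow, one_mul, Nat.sub_self, pow_zero, Nat.choose_self, Nat.cast_one] at h
    linarith
  refine Eq.trans ?_ (congrArg (· / (N.factorial * (N - 1).factorial : ℝ)) hb)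
  simp only [Finset.sum_div]
  refine Finset.sum_congr rfl fun i hi => ?_
  have hi' : i ≤ N := (Finset.mem_range.1 hi).le
  rw [hG, Real.Gamma_nat_eq_factorial, ← Nat.cast_sub hi', Real.Gamma_nat_eq_factorial,
    Nat.cast_choose ℝ hi']
  have := Nat.cast_ne_zero (R := ℝ).2 (Nat.factorial_ne_zero N)
  field_simp

/-- The digamma values only contribute a constant next to the logarithm. -/
lemma exists_highSNROutage_eq {N : ℕ} (hN : 1 ≤ N) : ∃ K : ℝ, ∀ μ γth ρ : ℝ,
    highSNROutage N μ γth ρ = (-Real.log (N * γth / (μ * ρ)) / (N.factorial * (N - 1).factorial) -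
      K) * (N * γth / (μ * ρ)) ^ N := by
  refine ⟨∑ i ∈ Finset.range N, (-1 : ℝ) ^ (N - i) *
    ((Complex.digamma 1).re + (Complex.digamma ((N : ℂ) - i + 1)).re) /
      (Real.Gamma N * Real.Gamma ((i : ℝ) + 1) * Real.Gamma ((N : ℝ) - i + 1)), fun μ γth ρ => ?_⟩
  have h : -Real.log (N * γth / (μ * ρ)) / (N.factorial * (N - 1).factorial) =
      Real.log (N * γth / (μ * ρ)) * (-1 / (N.factorial * (N - 1).factorial)) := by ring
  rw [h, ← sum_alternating_inv_Gamma hN, Finset.mul_sum, ← Finset.sum_sub_distrib, Finset.sum_mul,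
    highSNROutage]
  refine Finset.sum_congr rfl fun i _ => ?_
  ring

/-- `κᴺ / (N! (N-1)!)` with `κ = N γ_th / μ`, the coefficient of `ln ρ₁ / ρ₁ᴺ` in the outage
probability. -/
def leadingCoeff (N : ℕ) (μ γth : ℝ) : ℝ :=
  (N * γth / μ) ^ N / (N.factorial * (N - 1).factorial)

lemma leadingCoeff_pos {N : ℕ} (hN : 1 ≤ N) {μ γth : ℝ} (hμ : 0 < μ) (hγ : 0 < γth) :
    0 < leadingCoeff N μ γth := by
  have : (0 : ℝ) < N := by exact_mod_cast hN
  unfold leadingCoeff; positivity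

lemma tendsto_highSNROutage_div {N : ℕ} (hN : 1 ≤ N) {μ γth : ℝ} (hμ : 0 < μ) (hγ : 0 < γth) :
    Tendsto (fun ρ : ℝ => highSNROutage N μ γth ρ / (Real.log ρ / ρ ^ N)) atTop
      (𝓝 (leadingCoeff N μ γth)) := by
  have hN0 : (0 : ℝ) < N := by exact_mod_cast hN
  obtain ⟨K, hK⟩ := exists_highSNROutage_eq hN
  have h1 : Tendsto (fun ρ : ℝ => (1 - Real.log (N * γth / μ) / Real.log ρ) /
      (N.factorial * (N - 1).factorial) * (N * γth / μ) ^ N -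
      K * (N * γth / μ) ^ N / Real.log ρ) atTop (𝓝 ((1 - 0) /
      (N.factorial * (N - 1).factorial) * (N * γth / μ) ^ N - 0)) :=
    ((((tendsto_const_nhds.div_atTop Real.tendsto_log_atTop).const_sub 1).div_const _).mul_const
      _).sub (tendsto_const_nhds.div_atTop Real.tendsto_log_atTop)
  have hval : (1 - 0) / ((N.factorial : ℝ) * (N - 1).factorial) * (N * γth / μ) ^ N - 0 =
      leadingCoeff N μ γth := by
    unfold leadingCoeff; ring
  rw [hval] at h1
  refine h1.congr' ?_
  filter_upwards [eventually_gt_atTop 1] with ρ hρ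
  have hρ0 : 0 < ρ := by linarith
  have hlog := Real.log_pos hρ
  rw [hK, ← div_div _ μ ρ, Real.log_div (by positivity) hρ0.ne', div_pow _ ρ]
  field_simp
  ring

/-- The logarithm of a quantity of exact order `ln ρ / ρᴺ` is `-N ln ρ` to first order. -/
lemma tendsto_neg_log_div_log {ι : Type*} {l : Filter ι} {ρ f : ι → ℝ} {c : ℝ} (N : ℕ) (hc : 0 < c)
    (hρ : Tendsto ρ l atTop)
    (hf : Tendsto (fun k => f k / (Real.log (ρ k) / ρ k ^ N)) l (𝓝 c)) :
    Tendsto (fun k => -Real.log (f k) / Real.log (ρ k)) l (𝓝 N) := by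
  have hΛ : Tendsto (fun k => Real.log (ρ k)) l atTop := Real.tendsto_log_atTop.comp hρ
  have h1 := (hf.log hc.ne').div_atTop hΛ
  have h2 : Tendsto (fun k => Real.log (Real.log (ρ k)) / Real.log (ρ k)) l (𝓝 0) :=
    Real.isLittleO_log_id_atTop.tendsto_div_nhds_zero.comp hΛ
  have h3 := (h1.add h2).const_sub (N : ℝ)
  rw [add_zero, sub_zero] at h3
  refine h3.congr' ?_
  filter_upwards [hρ.eventually_gt_atTop 1, hf.eventually (lt_mem_nhds hc)] with k hk hfk
  have hlog := Real.log_pos hk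
  have hk0 : 0 < ρ k := by linarith
  have hf0 : f k ≠ 0 := by
    rintro h0
    rw [h0, zero_div] at hfk
    exact hfk.false
  rw [Real.log_div hf0 (by positivity), Real.log_div hlog.ne' (by positivity), Real.log_pow]
  field_simp
  ring

namespace RelayParams

/-- The interference contributes a bounded amount to the mean combined power, so
`δ ρ₁ → N γ_th / μ`. -/
lemma tendsto_productThreshold_mul {N : ℕ} (hN : 1 ≤ N) {μ ρI γth : ℝ} (hμ : 0 < μ) (hγ : 0 < γth)
    {ι : Type*} {l : Filter ι} {p : ι → RelayParams}
    (hρ₂ : ∀ k, (p k).ρ₂ = μ * (p k).ρ₁) (hρI : ∀ k, (p k).ρI = ρI)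
    (hρ₁ : Tendsto (fun k => (p k).ρ₁) l atTop) :
    Tendsto (fun k => (p k).productThreshold N γth * (p k).ρ₁) l (𝓝 (N * γth / μ)) := by
  have hbd (k : ι) : (p k).meanCombinedPower N / (p k).N₀ ∈
      Set.Icc (N * (p k).ρ₁ + 1) (N * (p k).ρ₁ + N * ρI + 1) := by
    have hN₀ := (p k).N₀_pos
    obtain ⟨h1, h2⟩ := (p k).meanCombinedPower_mem_Icc hN
    rw [Set.mem_Icc, le_div_iff₀ hN₀, div_le_iff₀ hN₀, ← hρI k, ρ₁, RelayParams.ρI]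
    constructor
    · refine le_trans (le_of_eq ?_) h1
      field_simp
    · refine h2.trans (le_of_eq ?_)
      field_simp
  have heq (k : ι) : (p k).productThreshold N γth * (p k).ρ₁ =
      γth / μ * ((p k).meanCombinedPower N / (p k).N₀ / (p k).ρ₁) := by
    have := (p k).ρ₁_pos; have := (p k).N₀_pos
    rw [productThreshold, hρ₂ k]
    field_simp
  have hlim : Tendsto (fun k => (p k).meanCombinedPower N / (p k).N₀ / (p k).ρ₁) l (𝓝 (N : ℝ)) := by
    have hu : Tendsto (fun k => (N : ℝ) + (N * ρI + 1) / (p k).ρ₁) l (𝓝 N) := by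
      simpa using (tendsto_const_nhds (x := (N * ρI + 1 : ℝ)).div_atTop hρ₁).const_add (N : ℝ)
    refine tendsto_of_tendsto_of_tendsto_of_le_of_le tendsto_const_nhds hu (fun k => ?_) fun k => ?_
    · have := (p k).ρ₁_pos
      have := (hbd k).1
      simp only
      rw [le_div_iff₀ (p k).ρ₁_pos]; linarith
    · have := (p k).ρ₁_pos
      have h := (hbd k).2
      simp only
      rw [div_le_iff₀ (p k).ρ₁_pos, add_mul, div_mul_cancel₀ _ this.ne']; linarith
  simp_rw [heq]
  have h := hlim.const_mul (γth / μ)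
  rwa [div_mul_eq_mul_div, mul_comm γth] at h

/-- The squeeze: with `δ = productThreshold` and `L = -ln δ`, the outage probability is
asymptotic to `δᴺ L / (N! (N-1)!)`. -/
lemma tendsto_outageNoICI_div {N : ℕ} (hN : 1 ≤ N) {μ ρI γth : ℝ} (hμ : 0 < μ) (hγ : 0 < γth)
    {ι : Type*} {l : Filter ι} {p : ι → RelayParams}
    (hρ₂ : ∀ k, (p k).ρ₂ = μ * (p k).ρ₁) (hρI : ∀ k, (p k).ρI = ρI)
    (hδ : Tendsto (fun k => -Real.log ((p k).productThreshold N γth)) l atTop) :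
    Tendsto (fun k => (p k).outageNoICI N γth / ((p k).productThreshold N γth ^ N *
      -Real.log ((p k).productThreshold N γth) / (N.factorial * (N - 1).factorial))) l (𝓝 1) := by
  have hN0 : (0 : ℝ) < N := by exact_mod_cast hN
  set C : ℝ := ∫ z, (ρI * |z| + 1) ^ N ∂(gammaMeasure N 1) with hC
  set B : ℝ := (μ / N) ^ N * (N - 1).factorial * C with hB
  refine tendsto_of_tendsto_of_tendsto_of_le_of_le' (tendsto_lower_factor.comp hδ)
    ((tendsto_upper_factor N (N - 1).factorial B).comp hδ) ?_ ?_
  · filter_upwards [hδ.eventually_gt_atTop 0] with k hL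
    have hδ0 := (p k).productThreshold_pos hN hγ
    have h := (p k).le_outageNoICI hN hγ hL (neg_neg _).symm
    simp only [Function.comp]
    rw [le_div_iff₀ (by positivity)]
    refine le_trans (le_of_eq ?_) h
    set L := -Real.log ((p k).productThreshold N γth)
    field_simp
  · filter_upwards [hδ.eventually_gt_atTop 1] with k hL
    have hδ0 := (p k).productThreshold_pos hN hγ
    have hρ₁ := (p k).ρ₁_pos
    have hδ1 : (p k).productThreshold N γth ≤ 1 := by
      by_contra! h
      linarith [Real.log_pos h]
    have hlogL := Real.log_pos hL
    -- The weight `η = 1 / ln L` tends to zero while `(1 + 1 / η)ᴺ` stays negligible against `L`.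
    have h := (p k).outageNoICI_le hN hγ (one_div_pos.2 hlogL) hδ1
    rw [hρI k, one_div_one_div, ← hC] at h
    have hCpos : 0 ≤ C := by
      have := hρI k ▸ (p k).ρI_pos
      exact integral_nonneg fun z => by simp only [Pi.zero_apply]; positivity
    have hε : γth / (p k).ρ₁ ≤ μ / N * (p k).productThreshold N γth := by
      have hN₀ := (p k).N₀_pos
      have hm : N * (p k).ρ₁ ≤ (p k).meanCombinedPower N / (p k).N₀ := by
        rw [le_div_iff₀ hN₀, ρ₁]
        refine le_trans (le_of_eq ?_) ((le_add_of_nonneg_right hN₀.le).trans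
          ((p k).meanCombinedPower_mem_Icc hN).1)
        field_simp
      calc γth / (p k).ρ₁ = μ / N * (γth * (N * (p k).ρ₁) / ((p k).ρ₁ * (μ * (p k).ρ₁))) := by
            field_simp
        _ ≤ _ := by rw [productThreshold, hρ₂ k]; gcongr
    simp only [Function.comp]
    rw [div_le_iff₀ (by positivity)]
    set L := -Real.log ((p k).productThreshold N γth)
    set δ := (p k).productThreshold N γth
    calc _ ≤ _ := h
      _ ≤ δ ^ N / N.factorial + (1 + 1 / Real.log L) ^ N / N.factorial *
            (δ ^ N * (L + 1) / (N - 1).factorial) +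
          (1 + Real.log L) ^ N * (μ / N * δ) ^ N / N.factorial * C := by gcongr
      _ = _ := by
          rw [hB, mul_pow (μ / N)]
          have : (0 : ℝ) < N.factorial := by positivity
          have : (0 : ℝ) < (N - 1).factorial := by positivity
          field_simp

lemma tendsto_outageNoICI_div_log_div_pow {N : ℕ} (hN : 1 ≤ N) {μ ρI γth : ℝ} (hμ : 0 < μ)
    (hγ : 0 < γth) {ι : Type*} {l : Filter ι} {p : ι → RelayParams}
    (hρ₂ : ∀ k, (p k).ρ₂ = μ * (p k).ρ₁) (hρI : ∀ k, (p k).ρI = ρI)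
    (hρ₁ : Tendsto (fun k => (p k).ρ₁) l atTop) :
    Tendsto (fun k => (p k).outageNoICI N γth / (Real.log (p k).ρ₁ / (p k).ρ₁ ^ N)) l
      (𝓝 (leadingCoeff N μ γth)) := by
  have hN0 : (0 : ℝ) < N := by exact_mod_cast hN
  have hκ := tendsto_productThreshold_mul hN hμ hγ hρ₂ hρI hρ₁
  have hΛ : Tendsto (fun k => Real.log (p k).ρ₁) l atTop := Real.tendsto_log_atTop.comp hρ₁
  have hlogκ := hκ.log (by positivity)
  have hL (k : ι) : -Real.log ((p k).productThreshold N γth) =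
      Real.log (p k).ρ₁ - Real.log ((p k).productThreshold N γth * (p k).ρ₁) := by
    rw [Real.log_mul ((p k).productThreshold_pos hN hγ).ne' (p k).ρ₁_pos.ne']
    ring
  have hLtop : Tendsto (fun k => -Real.log ((p k).productThreshold N γth)) l atTop := by
    simp_rw [hL, sub_eq_add_neg]
    exact hΛ.atTop_add hlogκ.neg
  have hLdiv : Tendsto (fun k => -Real.log ((p k).productThreshold N γth) / Real.log (p k).ρ₁) l
      (𝓝 1) := by
    have h := (hlogκ.div_atTop hΛ).const_sub 1
    rw [sub_zero] at h
    refine h.congr' ?_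
    filter_upwards [hΛ.eventually_gt_atTop 0] with k hk
    rw [hL, sub_div, div_self hk.ne']
  have h := (tendsto_outageNoICI_div hN hμ hγ hρ₂ hρI hLtop).mul
    (((hκ.pow N).mul hLdiv).div_const (N.factorial * (N - 1).factorial : ℝ))
  rw [one_mul, mul_one] at h
  refine h.congr' ?_
  filter_upwards [hΛ.eventually_gt_atTop 0, hLtop.eventually_gt_atTop 0] with k hk hk'
  have := (p k).productThreshold_pos hN hγ
  have := (p k).ρ₁_pos
  simp only [mul_pow]
  set L := -Real.log ((p k).productThreshold N γth)
  field_simp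

end RelayParams

end

theorem theorem12 (N : ℕ) (hN : 1 ≤ N) (μ ρI γth : ℝ) (hμ : 0 < μ) (hγ : 0 < γth)
    {ι : Type*} (l : Filter ι) (p : ι → RelayParams)
    (hρ₂ : ∀ k, (p k).ρ₂ = μ * (p k).ρ₁) (hρI : ∀ k, (p k).ρI = ρI)
    (hρ₁ : Tendsto (fun k => (p k).ρ₁) l atTop) :
    (fun k => (p k).outageNoICI N γth) ~[l] (fun k => highSNROutage N μ γth (p k).ρ₁) ∧
    (fun k => (p k).outageNoICI N γth) =Θ[l]
      (fun k => Real.log (p k).ρ₁ / (p k).ρ₁ ^ N) ∧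
    Tendsto (fun k => -Real.log ((p k).outageNoICI N γth) / Real.log (p k).ρ₁) l (𝓝 (N : ℝ)) := by
  have hc := leadingCoeff_pos hN hμ hγ
  have hP := RelayParams.tendsto_outageNoICI_div_log_div_pow hN hμ hγ hρ₂ hρI hρ₁
  have hH := (tendsto_highSNROutage_div hN hμ hγ).comp hρ₁
  refine ⟨?_, ?_, tendsto_neg_log_div_log N hc hρ₁ hP⟩
  · have hne : ∀ᶠ k in l, highSNROutage N μ γth (p k).ρ₁ ≠ 0 := by
      filter_upwards [hH.eventually (lt_mem_nhds hc)] with k hk h0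
      simp only [Function.comp] at hk
      rw [h0, zero_div] at hk
      exact hk.false
    rw [isEquivalent_iff_tendsto_one hne]
    have h := hP.div hH hc.ne'
    rw [div_self hc.ne'] at h
    refine h.congr' ?_
    filter_upwards [hρ₁.eventually_gt_atTop 1] with k hk
    have hlog := Real.log_pos hk
    have : 0 < (p k).ρ₁ := by linarith
    simp only [Function.comp, Pi.div_apply]
    rw [div_div_div_cancel_right₀ (by positivity)]
  · exact (isTheta_of_div_tendsto_nhds_ne_zero hP hc.ne').symm
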